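/- Let $q\ge 1$ be an odd integer, $m\ge 0$ an integer, and $N=q\,2^m$. The (unnormalized) $N$-point DCT-II has the matrix $C_N=\bigl[\cos\bigl(\pi(2n+1)k/(2N)\bigr)\bigr]_{k,n=0}^{N-1}$, and a real $N\times N$ matrix $\tilde C_N$ is called a scaled $N$-point DCT-II if $C_N=\Pi\,\Delta\,\tilde C_N$ with a permutation matrix $\Pi$ and a diagonal matrix $\Delta$. Transforms are computed by finite flow graphs made of additions, subtractions, shifts (multiplications by powers of two) and multiplications by real constants; only the last are counted as multiplications. Let $\tilde\mu(N)$ be the least number of multiplications with which some scaled $N$-point DCT-II can be computed. A PFA-based (prime-factor) scaled DCT-II of length $N=q\,2^m$ is a scaled $N$-point DCT-II computed by the following cascade: the input is reordered by the prime factor index map into a $2^m\times q$ array; one fixed scaled $q$-point DCT-II is applied $2^m$ times; one fixed scaled $2^m$-point DCT-II is applied $q$ times; and a last stage merges the results into the outputs. Here the prime factor index map sends sample $n$ to the position $(a,b)$, $0\le a<2^m$, $0\le b<q$, with $2n+1\equiv\pm(2a+1)\pmod{4\cdot 2^m}$ and $2n+1\equiv\pm(2b+1)\pmod{4q}$. Then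 for every scaled $q$-point DCT-II that is computed with $s$ multiplications there is a PFA-based scaled DCT-II of length $N=q\,2^m$, using it as its transform of length $q$, that requires at most $$2^m s+\tfrac52 N-q\,\frac{m(m+3)+5}{2}-2^{m-1}+\tfrac12$$ multiplications. In particular, $$\tilde\mu(N)\le 2^m\,\tilde\mu(q)+\tfrac52 N-q\,\frac{m(m+3)+5}{2}-2^{m-1}+\tfrac12 .$$ -/

import Mathlib

/-!
Let `N = q p` with `p = 2 ^ m`. As `p` and `q` are coprime, a frequency `K < N` can be written as
`K = u q + v p` with `0 ≤ u < p` and `|v| < q`. For odd `x`, with `c M k = cos (π k x / (2 M))`, the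
addition theorem gives `c N K = c p u * c q v - c p (p - u) * c q (q - v)`. So every row of the
DCT-II of length `N` is, in the order of samples that the prime factor index map prescribes and up
to sign, either a row of the product of the two shorter transforms or the sum or difference of the
products at the complementary frequencies `(u, v)` and `(p - u, q - v)`; there are
`(p - 1) * (q - 1) / 2` such pairs. When the short transforms are scaled, the two products carry
unrelated scale factors, and one multiplication by their ratio realigns them; the remaining factor
moves into the scaling of the output.

The scaled transform of length `2 ^ m` comes from `cos ((2 n + 1) φ) = cos φ * U`, where `U` is an
integer combination of the `cos (2 j φ)`: up to scaling it is a rational transform followed by the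
matrix of the `cos (π k j / 2 ^ m)`. Splitting by the parity of `k`, and then by that of `j`, leaves
matrices `cos (π k j / 2 ^ (r + 2))` with odd `k` and `j`. As `5` generates the units that are `1`
modulo `4`, these are Hankel matrices of size `2 ^ r` up to signs and repetition of rows and
columns, and interpolation at `2 ^ (r + 1) - 1` rational points (Toom–Cook) computes them with as
many multiplications. The rational matrices are free once their denominators are moved into the
scaling.
-/

open Matrix
open scoped Kronecker

/-- The (unnormalized) matrix of the `N`-point DCT-II; the row index `k` is the frequency and the
column index `n` is the position of the input sample. -/
noncomputable def dct2 (N : ℕ) : Matrix (Fin N) (Fin N) ℝ :=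
  Matrix.of fun k n =>
    Real.cos (Real.pi * (2 * ((n : ℕ) : ℝ) + 1) * ((k : ℕ) : ℝ) / (2 * (N : ℝ)))

/-- `S` is a matrix of a scaled `N`-point DCT-II: the DCT-II matrix is a reordering matrix times a
diagonal matrix of scale factors times `S`. -/
def IsScaledDCT2 {N : ℕ} (S : Matrix (Fin N) (Fin N) ℝ) : Prop :=
  ∃ (σ : Equiv.Perm (Fin N)) (d : Fin N → ℝ),
    dct2 N = σ.permMatrix ℝ * Matrix.diagonal d * S

/-- `FlowGraph t V`: some finite flow graph with inputs `x i` (`i : ι`) that consists of additions,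
subtractions, shifts (multiplications by powers of two) and exactly `t` multiplications by real
constants has `V` as the set of the quantities that it computes, each of them regarded as a
function of the input `x`. -/
inductive FlowGraph {ι : Type} : ℕ → Set ((ι → ℝ) → ℝ) → Prop
  | input : FlowGraph 0 (Set.range fun (i : ι) (x : ι → ℝ) => x i)
  | add {t : ℕ} {V : Set ((ι → ℝ) → ℝ)} {u v : (ι → ℝ) → ℝ} (h : FlowGraph t V)
      (hu : u ∈ V) (hv : v ∈ V) : FlowGraph t (insert (fun x => u x + v x) V)
  | sub {t : ℕ} {V : Set ((ι → ℝ) → ℝ)} {u v : (ι → ℝ) → ℝ} (h : FlowGraph t V)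
      (hu : u ∈ V) (hv : v ∈ V) : FlowGraph t (insert (fun x => u x - v x) V)
  | shift {t : ℕ} {V : Set ((ι → ℝ) → ℝ)} {u : (ι → ℝ) → ℝ} (k : ℤ) (h : FlowGraph t V)
      (hu : u ∈ V) : FlowGraph t (insert (fun x => (2 : ℝ) ^ k * u x) V)
  | mul {t : ℕ} {V : Set ((ι → ℝ) → ℝ)} {u : (ι → ℝ) → ℝ} (c : ℝ) (h : FlowGraph t V)
      (hu : u ∈ V) : FlowGraph (t + 1) (insert (fun x => c * u x) V)

/-- The transform `x ↦ M x` is computed by a flow graph with exactly `t` multiplications. -/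
def ComputesWith {κ ι : Type} [Fintype ι] (M : Matrix κ ι ℝ) (t : ℕ) : Prop :=
  ∃ V : Set ((ι → ℝ) → ℝ), FlowGraph t V ∧ ∀ k : κ, (fun x => (M *ᵥ x) k) ∈ V

/-- The multiplicative complexity of the scaled `N`-point DCT-II: the least number of
multiplications in a flow graph that computes some scaled `N`-point DCT-II. -/
noncomputable def scaledMulComplexity (N : ℕ) : ℕ :=
  sInf {t : ℕ | ∃ S : Matrix (Fin N) (Fin N) ℝ, IsScaledDCT2 S ∧ ComputesWith S t}

/-- The input reordering of the prime factor algorithm for the DCT-II of length `q * p`: sample `n`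
goes to the position `(a, b)` with `2 n + 1 ≡ ± (2 a + 1)` modulo `4 p` and
`2 n + 1 ≡ ± (2 b + 1)` modulo `4 q`, so that `cos (π (2 n + 1) i / (2 p))` is
`cos (π (2 a + 1) i / (2 p))` for all integers `i`, and likewise for `q` and `b`. -/
def IsPrimeFactorMap {p q : ℕ} (e : Fin (q * p) ≃ Fin p × Fin q) : Prop :=
  ∀ n : Fin (q * p),
    ((2 * ((n : ℕ) : ℤ) + 1 ≡ 2 * (((e n).1 : ℕ) : ℤ) + 1 [ZMOD 4 * (p : ℤ)]) ∨
      (2 * ((n : ℕ) : ℤ) + 1 ≡ -(2 * (((e n).1 : ℕ) : ℤ) + 1) [ZMOD 4 * (p : ℤ)])) ∧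
    ((2 * ((n : ℕ) : ℤ) + 1 ≡ 2 * (((e n).2 : ℕ) : ℤ) + 1 [ZMOD 4 * (q : ℤ)]) ∨
      (2 * ((n : ℕ) : ℤ) + 1 ≡ -(2 * (((e n).2 : ℕ) : ℤ) + 1) [ZMOD 4 * (q : ℤ)]))

/-- A prime-factor (PFA) factorization of a scaled DCT-II of length `q * p`: the input is reordered
into a `p × q` array, a scaled `q`-point DCT-II is applied `p` times along one direction, a scaled
`p`-point DCT-II is applied `q` times along the other one, and a last stage merges the results into
the outputs of a scaled DCT-II of length `q * p`. -/
structure ScaledPFA (q p : ℕ) where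
  /-- the reordering of the input -/
  split : Fin (q * p) ≃ Fin p × Fin q
  split_spec : IsPrimeFactorMap split
  /-- the scaled transform of length `q` -/
  Sq : Matrix (Fin q) (Fin q) ℝ
  Sq_scaled : IsScaledDCT2 Sq
  /-- the scaled transform of length `p` -/
  Sp : Matrix (Fin p) (Fin p) ℝ
  Sp_scaled : IsScaledDCT2 Sp
  /-- the last stage -/
  merge : Matrix (Fin (q * p)) (Fin p × Fin q) ℝ
  result_scaled : IsScaledDCT2
    ((merge * ((Sp ⊗ₖ (1 : Matrix (Fin q) (Fin q) ℝ)) *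
      ((1 : Matrix (Fin p) (Fin p) ℝ) ⊗ₖ Sq))).submatrix id split)

/-- The scaled DCT-II matrix of length `q * p` that the factorization produces. -/
def ScaledPFA.matrix {q p : ℕ} (A : ScaledPFA q p) : Matrix (Fin (q * p)) (Fin (q * p)) ℝ :=
  (A.merge * ((A.Sp ⊗ₖ (1 : Matrix (Fin q) (Fin q) ℝ)) *
    ((1 : Matrix (Fin p) (Fin p) ℝ) ⊗ₖ A.Sq))).submatrix id A.split

/-- The cascade uses `t` multiplications, when its `p` transforms of length `q`, its `q` transforms
of length `p` and its last stage are computed one after the other, each by a flow graph of its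
own, the one for length `q` having `s` multiplications. -/
def ScaledPFA.UsesMul {q p : ℕ} (A : ScaledPFA q p) (s t : ℕ) : Prop :=
  ∃ a c : ℕ, ComputesWith A.Sq s ∧ ComputesWith A.Sp a ∧ ComputesWith A.merge c ∧
    t = p * s + q * a + c

/-- Any linear form can be added to the quantities that a flow graph computes. -/
theorem FlowGraph.exists_form {ι : Type} [Fintype ι] [Nonempty ι] {t : ℕ}
    {V : Set ((ι → ℝ) → ℝ)} (h : FlowGraph t V)
    (hV : ∀ i : ι, (fun x : ι → ℝ => x i) ∈ V) (w : ι → ℝ) (s : Finset ι) :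
    ∃ (t' : ℕ) (V' : Set ((ι → ℝ) → ℝ)), FlowGraph t' V' ∧ V ⊆ V' ∧
      (fun x => ∑ i ∈ s, w i * x i) ∈ V' := by
  classical
  induction s using Finset.induction_on with
  | empty =>
    refine ⟨_, _, FlowGraph.mul 0 h (hV (Classical.arbitrary ι)), Set.subset_insert _ _, ?_⟩
    simp
  | insert a s ha ih =>
    obtain ⟨t', V', h', hs, hm⟩ := ih
    have h2 := FlowGraph.mul (w a) h' (hs (hV a))
    have h3 := FlowGraph.add h2 (Set.mem_insert _ _) (Set.mem_insert_of_mem _ hm)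
    refine ⟨_, _, h3,
      (hs.trans (Set.subset_insert _ _)).trans (Set.subset_insert _ _), ?_⟩
    left
    funext x
    rw [Finset.sum_insert ha]

/-- Every matrix is computed by some flow graph. -/
theorem exists_computesWith {κ ι : Type} [Fintype κ] [Fintype ι] [Nonempty ι]
    (M : Matrix κ ι ℝ) : ∃ t, ComputesWith M t := by
  classical
  have key : ∀ s : Finset κ, ∃ (t : ℕ) (V : Set ((ι → ℝ) → ℝ)), FlowGraph t V ∧
      (∀ i : ι, (fun x : ι → ℝ => x i) ∈ V) ∧ ∀ k ∈ s, (fun x => (M *ᵥ x) k) ∈ V := by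
    intro s
    induction s using Finset.induction_on with
    | empty => exact ⟨_, _, FlowGraph.input, fun i => ⟨i, rfl⟩, by simp⟩
    | insert a s ha ih =>
      obtain ⟨t, V, h, hV, hs⟩ := ih
      obtain ⟨t', V', h', hsub, hm⟩ := h.exists_form hV (M a) Finset.univ
      refine ⟨t', V', h', fun i => hsub (hV i), fun k hk => ?_⟩
      rcases Finset.mem_insert.1 hk with rfl | hk
      · exact hm
      · exact hsub (hs k hk)
  obtain ⟨t, V, h, -, hs⟩ := key Finset.univ
  exact ⟨t, V, h, fun k => hs k (Finset.mem_univ k)⟩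

/-- The minimum that defines `scaledMulComplexity` is attained. -/
theorem scaledMulComplexity_spec (N : ℕ) (hN : 0 < N) :
    ∃ S : Matrix (Fin N) (Fin N) ℝ, IsScaledDCT2 S ∧ ComputesWith S (scaledMulComplexity N) := by
  have : Nonempty (Fin N) := ⟨⟨0, hN⟩⟩
  obtain ⟨t, ht⟩ := exists_computesWith (dct2 N)
  exact Nat.sInf_mem
    (s := {t : ℕ | ∃ S : Matrix (Fin N) (Fin N) ℝ, IsScaledDCT2 S ∧ ComputesWith S t})
    ⟨t, dct2 N, ⟨1, 1, by ext i j; simp⟩, ht⟩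

/-! ### Composition of flow graphs -/

section Derivable

variable {ι κ : Type}

/-- Every flow graph that computes the quantities in `V` can be continued, with `n` further
multiplications, to one that also computes the quantities in `W`. -/
def DerivableWith (V W : Set ((ι → ℝ) → ℝ)) (n : ℕ) : Prop :=
  ∀ ⦃t : ℕ⦄ ⦃U : Set ((ι → ℝ) → ℝ)⦄, V ⊆ U → FlowGraph t U →
    ∃ U', U ⊆ U' ∧ W ⊆ U' ∧ FlowGraph (t + n) U'

namespace DerivableWith

variable {V W X : Set ((ι → ℝ) → ℝ)} {m n : ℕ}

theorem of_subset (h : W ⊆ V) : DerivableWith V W 0 :=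
  fun _ U hV hU => ⟨U, subset_rfl, h.trans hV, hU⟩

theorem mono {V' : Set ((ι → ℝ) → ℝ)} (h : DerivableWith V W n) (hV : V ⊆ V') (hX : X ⊆ W) :
    DerivableWith V' X n := by
  intro t U hVU hU
  obtain ⟨U', hUU', hW, hU'⟩ := h (hV.trans hVU) hU
  exact ⟨U', hUU', hX.trans hW, hU'⟩

theorem mono_right (h : DerivableWith V W n) (hX : X ⊆ W) : DerivableWith V X n :=
  h.mono subset_rfl hX

theorem trans (hW : DerivableWith V W m) (hX : DerivableWith W X n) :
    DerivableWith V X (m + n) := by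
  intro t U hV hU
  obtain ⟨U₁, hUU₁, hWU₁, hU₁⟩ := hW hV hU
  obtain ⟨U₂, hU₁₂, hXU₂, hU₂⟩ := hX hWU₁ hU₁
  exact ⟨U₂, hUU₁.trans hU₁₂, hXU₂, by rwa [← add_assoc]⟩

theorem union (hW : DerivableWith V W m) (hX : DerivableWith V X n) :
    DerivableWith V (W ∪ X) (m + n) := by
  intro t U hV hU
  obtain ⟨U₁, hUU₁, hWU₁, hU₁⟩ := hW hV hU
  obtain ⟨U₂, hU₁₂, hXU₂, hU₂⟩ := hX (hV.trans hUU₁) hU₁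
  exact ⟨U₂, hUU₁.trans hU₁₂, Set.union_subset (hWU₁.trans hU₁₂) hXU₂, by rwa [← add_assoc]⟩

theorem insert_right {w : (ι → ℝ) → ℝ} (hW : DerivableWith V W m)
    (hw : DerivableWith W {w} n) : DerivableWith V (insert w W) (m + n) :=
  hW.trans (hw.union (of_subset subset_rfl))

theorem iUnion [Fintype κ] {W : κ → Set ((ι → ℝ) → ℝ)} (h : ∀ k, DerivableWith V (W k) n) :
    DerivableWith V (⋃ k, W k) (Fintype.card κ * n) := by
  classical
  suffices ∀ F : Finset κ, DerivableWith V (⋃ k ∈ F, W k) (F.card * n) by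
    simpa using this Finset.univ
  intro F
  induction F using Finset.induction_on with
  | empty => simpa using of_subset (Set.empty_subset V)
  | insert k F hk ih =>
    rw [Finset.set_biUnion_insert, Finset.card_insert_of_notMem hk, Nat.succ_mul, add_comm]
    exact (h k).union ih

theorem of_op {w : (ι → ℝ) → ℝ}
    (h : ∀ ⦃t U⦄, V ⊆ U → FlowGraph t U → FlowGraph (t + n) (insert w U)) :
    DerivableWith V {w} n :=
  fun _ _ hV hU =>
    ⟨_, Set.subset_insert _ _, Set.singleton_subset_iff.2 (Set.mem_insert _ _), h hV hU⟩

theorem add {u v : (ι → ℝ) → ℝ} (hu : u ∈ V) (hv : v ∈ V) : DerivableWith V {u + v} 0 :=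
  of_op fun _ _ hV hU => hU.add (hV hu) (hV hv)

theorem sub {u v : (ι → ℝ) → ℝ} (hu : u ∈ V) (hv : v ∈ V) : DerivableWith V {u - v} 0 :=
  of_op fun _ _ hV hU => hU.sub (hV hu) (hV hv)

theorem shift {u : (ι → ℝ) → ℝ} (k : ℤ) (hu : u ∈ V) :
    DerivableWith V {fun x => (2 : ℝ) ^ k * u x} 0 :=
  of_op fun _ _ hV hU => hU.shift k (hV hu)

theorem const_mul {u : (ι → ℝ) → ℝ} (c : ℝ) (hu : u ∈ V) :
    DerivableWith V {fun x => c * u x} 1 :=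
  of_op fun _ _ hV hU => hU.mul c (hV hu)

theorem of_mem_closure (hV : V.Nonempty) {w : (ι → ℝ) → ℝ} (hw : w ∈ AddSubgroup.closure V) :
    DerivableWith V {w} 0 := by
  have zero : DerivableWith V {0} 0 := by
    obtain ⟨u, hu⟩ := hV
    simpa using sub hu hu
  induction hw using AddSubgroup.closure_induction with
  | mem w hw => exact of_subset (by simpa using hw)
  | zero => exact zero
  | add u v _ _ hu hv => exact (hu.union hv).trans (add (by simp) (by simp))
  | neg u _ hu => simpa using (zero.union hu).trans (sub (u := 0) (v := u) (by simp) (by simp))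

theorem of_subset_closure [Finite κ] (hV : V.Nonempty) {w : κ → (ι → ℝ) → ℝ}
    (hw : ∀ k, w k ∈ AddSubgroup.closure V) : DerivableWith V (Set.range w) 0 := by
  cases nonempty_fintype κ
  simpa using iUnion fun k => of_mem_closure hV (hw k)

end DerivableWith

theorem FlowGraph.derivableWith {W : Set ((κ → ℝ) → ℝ)} {t : ℕ} (h : FlowGraph t W)
    (y : κ → (ι → ℝ) → ℝ) :
    DerivableWith (Set.range y) ((fun w x => w fun k => y k x) '' W) t := by
  induction h with
  | input =>
    refine .of_subset ?_
    rintro _ ⟨_, ⟨k, rfl⟩, rfl⟩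
    exact ⟨k, rfl⟩
  | add _ hu hv ih =>
    rw [Set.image_insert_eq]
    exact ih.insert_right (.add (Set.mem_image_of_mem _ hu) (Set.mem_image_of_mem _ hv))
  | sub _ hu hv ih =>
    rw [Set.image_insert_eq]
    exact ih.insert_right (.sub (Set.mem_image_of_mem _ hu) (Set.mem_image_of_mem _ hv))
  | shift k _ hu ih =>
    rw [Set.image_insert_eq]
    exact ih.insert_right (.shift k (Set.mem_image_of_mem _ hu))
  | mul c _ hu ih =>
    rw [Set.image_insert_eq]
    exact ih.insert_right (.const_mul c (Set.mem_image_of_mem _ hu))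

end Derivable

section ComputesWith

variable {ι κ μ ρ : Type} [Fintype ι]

namespace ComputesWith

theorem of_derivableWith {M : Matrix κ ι ℝ} {t : ℕ}
    (h : DerivableWith (Set.range fun (i : ι) (x : ι → ℝ) => x i)
      (Set.range fun k x => (M *ᵥ x) k) t) : ComputesWith M t := by
  obtain ⟨U, -, hM, hU⟩ := h subset_rfl .input
  exact ⟨U, by simpa using hU, fun k => hM ⟨k, rfl⟩⟩

theorem derivableWith {M : Matrix κ ι ℝ} {t : ℕ} (h : ComputesWith M t)
    (y : ι → (ρ → ℝ) → ℝ) :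
    DerivableWith (Set.range y) (Set.range fun k x => (M *ᵥ fun i => y i x) k) t := by
  obtain ⟨U, hU, hM⟩ := h
  refine (hU.derivableWith y).mono_right ?_
  rintro _ ⟨k, rfl⟩
  exact ⟨_, hM k, rfl⟩

theorem mul [Fintype κ] {A : Matrix κ ι ℝ} {B : Matrix μ κ ℝ} {s t : ℕ}
    (hB : ComputesWith B s) (hA : ComputesWith A t) : ComputesWith (B * A) (s + t) := by
  refine of_derivableWith ?_
  rw [add_comm]
  simpa only [mulVec_mulVec] using
    (hA.derivableWith fun i x => x i).trans (hB.derivableWith fun k x => (A *ᵥ x) k)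

theorem submatrix [Fintype ρ] {M : Matrix κ ι ℝ} {t : ℕ} (h : ComputesWith M t)
    (f : μ → κ) (e : ρ ≃ ι) : ComputesWith (M.submatrix f e) t := by
  refine of_derivableWith ((h.derivableWith fun i x => x (e.symm i)).mono ?_ ?_)
  · exact Set.range_comp_subset_range e.symm fun (j : ρ) (x : ρ → ℝ) => x j
  · rintro _ ⟨k, rfl⟩
    exact ⟨f k, by simp only [submatrix_mulVec_equiv]; rfl⟩

theorem fromRows {A : Matrix κ ι ℝ} {B : Matrix μ ι ℝ} {s t : ℕ}
    (hA : ComputesWith A s) (hB : ComputesWith B t) :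
    ComputesWith (fromRows A B) (s + t) := by
  refine of_derivableWith (((hA.derivableWith _).union (hB.derivableWith _)).mono_right ?_)
  rintro _ ⟨k | k, rfl⟩
  · exact .inl ⟨k, rfl⟩
  · exact .inr ⟨k, rfl⟩

theorem blockDiagonal [Fintype κ] [DecidableEq κ] {M : Matrix μ ι ℝ} {t : ℕ}
    (h : ComputesWith M t) :
    ComputesWith (blockDiagonal fun _ : κ => M) (Fintype.card κ * t) := by
  have block (k : κ) : DerivableWith (Set.range fun (i : ι × κ) (x : ι × κ → ℝ) => x i)
      (Set.range fun j x => (M *ᵥ fun i => x (i, k)) j) t :=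
    (h.derivableWith fun i x => x (i, k)).mono (by rintro _ ⟨i, rfl⟩; exact ⟨(i, k), rfl⟩)
      subset_rfl
  refine of_derivableWith ((DerivableWith.iUnion block).mono_right ?_)
  rintro _ ⟨⟨j, k⟩, rfl⟩
  refine Set.mem_iUnion.2 ⟨k, j, ?_⟩
  funext x
  simp [mulVec, dotProduct, blockDiagonal_apply, Fintype.sum_prod_type]

theorem kronecker_one [Fintype κ] [DecidableEq κ] {M : Matrix μ ι ℝ} {t : ℕ}
    (h : ComputesWith M t) : ComputesWith (M ⊗ₖ (1 : Matrix κ κ ℝ)) (Fintype.card κ * t) := by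
  rw [Matrix.kronecker_one]
  exact h.blockDiagonal

theorem one_kronecker [Fintype κ] [DecidableEq κ] {M : Matrix μ ι ℝ} {t : ℕ}
    (h : ComputesWith M t) : ComputesWith ((1 : Matrix κ κ ℝ) ⊗ₖ M) (Fintype.card κ * t) := by
  rw [Matrix.one_kronecker, reindex_apply]
  exact h.blockDiagonal.submatrix _ _

end ComputesWith

theorem computesWith_intCast [Finite κ] [Nonempty ι] (R : Matrix κ ι ℤ) :
    ComputesWith (R.map ((↑) : ℤ → ℝ)) 0 := by
  refine .of_derivableWith (.of_subset_closure (Set.range_nonempty _) fun k => ?_)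
  have row_eq : (fun x => (R.map ((↑) : ℤ → ℝ) *ᵥ x) k) =
      ∑ i, R k i • fun x : ι → ℝ => x i := by
    ext x
    simp [mulVec, dotProduct]
  rw [row_eq]
  exact sum_mem fun i _ => zsmul_mem (AddSubgroup.subset_closure (Set.mem_range_self i)) _

theorem computesWith_diagonal [DecidableEq ι] (g : ι → ℝ) :
    ComputesWith (diagonal g) (Fintype.card ι) := by
  refine .of_derivableWith ?_
  have scaled (i : ι) : DerivableWith (Set.range fun (i : ι) (x : ι → ℝ) => x i)
      {fun x => g i * x i} 1 := .const_mul (g i) ⟨i, rfl⟩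
  simpa [mulVec_diagonal] using DerivableWith.iUnion scaled

theorem computesWith_add_mul_diagonal_mul [Finite κ] [Nonempty ι] [Fintype ρ] [DecidableEq ρ]
    (R : Matrix κ ι ℤ) (C : Matrix κ ρ ℤ) (g : ρ → ℝ) (A : Matrix ρ ι ℤ) :
    ComputesWith (R.map ((↑) : ℤ → ℝ) + C.map ((↑) : ℤ → ℝ) * diagonal g * A.map ((↑) : ℤ → ℝ))
      (Fintype.card ρ) := by
  classical
  have products : ComputesWith (fromRows ((1 : Matrix ι ι ℤ).map ((↑) : ℤ → ℝ))
      (diagonal g * A.map ((↑) : ℤ → ℝ))) (0 + (Fintype.card ρ + 0)) :=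
    (computesWith_intCast 1).fromRows ((computesWith_diagonal g).mul (computesWith_intCast A))
  have combine : ComputesWith (fromCols (R.map ((↑) : ℤ → ℝ)) (C.map ((↑) : ℤ → ℝ))) 0 := by
    simpa only [fromCols_map] using computesWith_intCast (fromCols R C)
  simpa [fromCols_mul_fromRows, Matrix.mul_assoc] using combine.mul products

end ComputesWith

theorem ScaledPFA.UsesMul.computesWith {q p s t : ℕ} {A : ScaledPFA q p} (h : A.UsesMul s t) :
    ComputesWith A.matrix t := by
  obtain ⟨a, c, hSq, hSp, hmerge, rfl⟩ := h
  have cascade := (hmerge.mul (hSp.kronecker_one.mul hSq.one_kronecker)).submatrix id A.split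
  simpa [ScaledPFA.matrix, Fintype.card_fin, add_comm, add_left_comm] using cascade

/-! ### Transforms that are rational up to few products -/

theorem intCast_num_apply {κ ι K : Type*} [Fintype κ] [Fintype ι] [Field K] [CharZero K]
    (M : Matrix κ ι ℚ) (i : κ) (j : ι) : (M.num i j : K) = M.den * M i j := by
  have den_ne_zero : (M.den : K) ≠ 0 := mod_cast M.den_ne_zero
  rw [← M.num_div_den i j]
  push_cast
  field_simp

/-- `L` is a rational matrix plus a real linear combination of `t` rational matrices `C r ⊗ A r` of
rank at most one. Up to clearing denominators, such a transform needs only the `t` multiplications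
by the coefficients `g r` of that combination. -/
def HasRationalRank {κ ι : Type} (L : Matrix κ ι ℝ) (t : ℕ) : Prop :=
  ∃ (R : Matrix κ ι ℚ) (C : Matrix κ (Fin t) ℚ) (g : Fin t → ℝ) (A : Matrix (Fin t) ι ℚ),
    ∀ i j, L i j = R i j + ∑ r, C i r * g r * A r j

namespace HasRationalRank

variable {κ ι μ : Type} {L L' : Matrix κ ι ℝ} {t t' : ℕ}

theorem of_forall_ratCast (h : ∀ i j, ∃ c : ℚ, L i j = c) : HasRationalRank L 0 := by
  choose R hR using h
  exact ⟨R, 0, 0, 0, by simpa using hR⟩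

theorem transpose (h : HasRationalRank L t) : HasRationalRank Lᵀ t := by
  obtain ⟨R, C, g, A, h⟩ := h
  refine ⟨Rᵀ, Aᵀ, g, Cᵀ, fun j i => ?_⟩
  simp only [transpose_apply, h]
  exact congrArg _ (Finset.sum_congr rfl fun r _ => by ring)

theorem ite_rows (P : κ → Prop) [DecidablePred P] (h : HasRationalRank L t)
    (h' : HasRationalRank L' t') :
    HasRationalRank (of fun i j => if P i then L i j else L' i j) (t + t') := by
  obtain ⟨R, C, g, A, h⟩ := h
  obtain ⟨R', C', g', A', h'⟩ := h'
  refine ⟨of fun i j => if P i then R i j else R' i j,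
    of fun i => Fin.append (fun r => if P i then C i r else 0) (fun r => if P i then 0 else C' i r),
    Fin.append g g', of fun r j => Fin.append (A · j) (A' · j) r, fun i j => ?_⟩
  by_cases hi : P i <;> simp [hi, h, h', Fin.sum_univ_add]

theorem mul_ratCast [Fintype ι] (h : HasRationalRank L t) (U : Matrix ι μ ℚ) :
    HasRationalRank (L * U.map ((↑) : ℚ → ℝ)) t := by
  obtain ⟨R, C, g, A, h⟩ := h
  refine ⟨R * U, C, g, A * U, fun i j => ?_⟩
  simp only [mul_apply, map_apply, h, add_mul, Finset.sum_add_distrib, Finset.sum_mul,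
    Finset.mul_sum, Rat.cast_sum, Rat.cast_mul]
  rw [Finset.sum_comm]
  simp only [mul_assoc]

theorem exists_computesWith [Finite κ] [Fintype ι] [Nonempty ι] (h : HasRationalRank L t) :
    ∃ D : ℝ, D ≠ 0 ∧ ComputesWith (D • L) t := by
  cases nonempty_fintype κ
  obtain ⟨R, C, g, A, h⟩ := h
  refine ⟨R.den, mod_cast R.den_ne_zero, ?_⟩
  have cleared : (R.den : ℝ) • L = R.num.map ((↑) : ℤ → ℝ) + C.num.map ((↑) : ℤ → ℝ) *
      diagonal (fun r => R.den / (C.den * A.den) * g r) * A.num.map ((↑) : ℤ → ℝ) := by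
    have hC : (C.den : ℝ) ≠ 0 := mod_cast C.den_ne_zero
    have hA : (A.den : ℝ) ≠ 0 := mod_cast A.den_ne_zero
    ext i j
    rw [Matrix.smul_apply, Matrix.add_apply, mul_apply, h, smul_eq_mul, mul_add, Finset.mul_sum]
    simp only [map_apply, mul_diagonal, intCast_num_apply]
    refine congrArg _ (Finset.sum_congr rfl fun r _ => ?_)
    field_simp
  rw [cleared]
  simpa using computesWith_add_mul_diagonal_mul R.num C.num _ A.num

end HasRationalRank

theorem exists_eq_sum_mul_pow {F : Type} [Field F] [CharZero F] (N : ℕ) (h : Fin N → F) :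
    ∃ g : Fin N → F, ∀ l : Fin N, h l = ∑ r : Fin N, g r * ((r : ℕ) : F) ^ (l : ℕ) := by
  let V : Matrix (Fin N) (Fin N) F := vandermonde fun r => ((r : ℕ) : F)
  have hV : IsUnit V.det :=
    (det_vandermonde_ne_zero_iff.2 fun r s hrs => Fin.ext (Nat.cast_injective hrs)).isUnit
  refine ⟨h ᵥ* V⁻¹, fun l => ?_⟩
  have solves : h ᵥ* V⁻¹ ᵥ* V = h := by
    rw [vecMul_vecMul, nonsing_inv_mul _ hV, vecMul_one]
  exact (congrFun solves l).symm

-- Toom–Cook: interpolation at `0, 1, …, n + n' - 2` writes `h (a + b)` as `∑ g r * r ^ a * r ^ b`.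
theorem hasRationalRank_hankel {κ ι : Type} {n n' : ℕ} (h : ℕ → ℝ) {a : κ → ℕ} {b : ι → ℕ}
    (ha : ∀ i, a i < n) (hb : ∀ j, b j < n') (s : κ → ℚ) (s' : ι → ℚ) :
    HasRationalRank (of fun i j => s i * s' j * h (a i + b j)) (n + n' - 1) := by
  obtain ⟨g, hg⟩ := exists_eq_sum_mul_pow (n + n' - 1) fun l => h l
  refine ⟨0, of fun i r => s i * (r : ℕ) ^ a i, g, of fun r j => s' j * (r : ℕ) ^ b j,
    fun i j => ?_⟩
  have lt : a i + b j < n + n' - 1 := by have := ha i; have := hb j; omega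
  simp only [of_apply, hg ⟨_, lt⟩, pow_add, Finset.mul_sum]
  push_cast
  rw [Matrix.zero_apply, Rat.cast_zero, zero_add]
  exact Finset.sum_congr rfl fun r _ => by ring

/-! ### Scaled DCT-II of length a power of two -/

/-- The cosines `cos (π u v / N)` that all the transforms below consist of: the entries of the
`N`-point DCT-II are the numbers `dctCos (2 * N) k (2 * n + 1)`. -/
noncomputable def dctCos (N : ℕ) (u v : ℤ) : ℝ :=
  Real.cos (u * v * (Real.pi / N))

section DctCos

variable {N : ℕ} (u v : ℤ)

theorem dctCos_comm : dctCos N u v = dctCos N v u := by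
  simp only [dctCos, mul_comm (u : ℝ)]

theorem dctCos_neg_left : dctCos N (-u) v = dctCos N u v := by
  simp [dctCos]

theorem dctCos_mul_mul_left {c : ℕ} (hc : c ≠ 0) : dctCos (c * N) (c * u) v = dctCos N u v := by
  have hc' : (c : ℝ) ≠ 0 := mod_cast hc
  simp only [dctCos]
  congr 1
  push_cast
  field_simp

theorem dctCos_add_mul_left (hN : N ≠ 0) (t : ℤ) :
    dctCos N (u + N * t) v = (-1) ^ (t * v) * dctCos N u v := by
  have angle : ((u + N * t : ℤ) : ℝ) * v * (Real.pi / N) =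
      u * v * (Real.pi / N) + (t * v : ℤ) * Real.pi := by
    push_cast
    field_simp
  rw [dctCos, angle, Real.cos_add_int_mul_pi, dctCos]

theorem dct2_apply (k n : Fin N) : dct2 N k n = dctCos (2 * N) k (2 * n + 1) := by
  rw [dct2, of_apply, dctCos]
  congr 1
  push_cast
  ring

theorem exists_dctCos_two_eq_ratCast : ∃ c : ℚ, dctCos 2 u v = c := by
  have angle : (u : ℝ) * v * (Real.pi / (2 : ℕ)) = (u * v : ℤ) * Real.pi / 2 := by
    push_cast
    ring
  rw [dctCos, angle]
  obtain ⟨w, hw | hw⟩ := Int.even_or_odd' (u * v)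
  · refine ⟨(-1) ^ w, ?_⟩
    rw [hw, show ((2 * w : ℤ) : ℝ) * Real.pi / 2 = w * Real.pi by push_cast; ring,
      Real.cos_int_mul_pi]
    push_cast
    rfl
  · refine ⟨0, ?_⟩
    rw [Rat.cast_zero, Real.cos_eq_zero_iff]
    exact ⟨w, by rw [hw]; push_cast; ring⟩

end DctCos

theorem five_pow_two_pow (r : ℕ) : ∃ w : ℤ, (5 : ℤ) ^ 2 ^ r = 1 + 2 ^ (r + 2) * (2 * w + 1) := by
  induction r with
  | zero => exact ⟨0, by norm_num⟩
  | succ r ih =>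
    obtain ⟨w, hw⟩ := ih
    refine ⟨w + 2 ^ r * (2 * w + 1) ^ 2, ?_⟩
    rw [pow_succ, pow_mul, hw]
    ring

theorem exists_modEq_five_pow {u : ℤ} (hu : u ≡ 1 [ZMOD 4]) (r : ℕ) :
    ∃ a < 2 ^ r, u ≡ 5 ^ a [ZMOD 2 ^ (r + 2)] := by
  induction r with
  | zero => exact ⟨0, by simp, by simpa using hu⟩
  | succ r ih =>
    obtain ⟨a, ha, hua⟩ := ih
    obtain ⟨t, rfl⟩ := Int.modEq_iff_add_fac.1 hua.symm
    obtain ⟨v, rfl | rfl⟩ := Int.even_or_odd' t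
    · exact ⟨a, by rw [pow_succ]; lia, (Int.modEq_iff_add_fac.2 ⟨v, by ring⟩).symm⟩
    · obtain ⟨w, hw⟩ := five_pow_two_pow r
      obtain ⟨z, hz⟩ : Odd ((5 : ℤ) ^ a) := Odd.pow (by decide)
      refine ⟨a + 2 ^ r, by rw [pow_succ]; lia, (Int.modEq_iff_add_fac.2 ?_).symm⟩
      refine ⟨v - (2 * z * w + z + w), ?_⟩
      rw [pow_add (5 : ℤ), hw, hz]
      ring

theorem exists_dctCos_eq_five_pow {u : ℤ} (hu : Odd u) (r : ℕ) : ∃ a < 2 ^ r, ∃ ε : ℚ,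
    ∀ v, Odd v → dctCos (2 ^ (r + 2)) u v = ε * dctCos (2 ^ (r + 2)) (5 ^ a) v := by
  wlog one_mod_four : u ≡ 1 [ZMOD 4] generalizing u with of_one_mod_four
  · have neg_one_mod_four : -u ≡ 1 [ZMOD 4] := by
      have := Int.odd_iff.1 hu
      simp only [Int.ModEq] at *
      lia
    simpa only [dctCos_neg_left] using of_one_mod_four hu.neg neg_one_mod_four
  obtain ⟨a, ha, hua⟩ := exists_modEq_five_pow one_mod_four r
  obtain ⟨t, rfl⟩ := Int.modEq_iff_add_fac.1 hua.symm
  refine ⟨a, ha, (-1) ^ t, fun v hv => ?_⟩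
  have shift := dctCos_add_mul_left (N := 2 ^ (r + 2)) (5 ^ a) v (by positivity) t
  rw [mul_comm t v, _root_.zpow_mul, hv.neg_one_zpow] at shift
  push_cast at shift ⊢
  exact shift

section DctCosRank

variable {κ ι : Type} (k : κ → ℤ) (j : ι → ℤ)

theorem hasRationalRank_dctCos_odd_odd (hk : ∀ x, Odd (k x)) (hj : ∀ y, Odd (j y)) (r : ℕ) :
    HasRationalRank (of fun x y => dctCos (2 ^ (r + 2)) (k x) (j y)) (2 ^ (r + 1) - 1) := by
  choose a ha s hs using fun x => exists_dctCos_eq_five_pow (hk x) r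
  choose b hb s' hs' using fun y => exists_dctCos_eq_five_pow (hj y) r
  have hankel (x : κ) (y : ι) : dctCos (2 ^ (r + 2)) (k x) (j y) =
      s x * s' y * dctCos (2 ^ (r + 2)) (5 ^ (a x + b y)) 1 := by
    rw [hs x _ (hj y), dctCos_comm, hs' y _ (Odd.pow (by decide)), mul_assoc]
    simp only [dctCos, pow_add]
    push_cast
    ring_nf
  simp only [hankel, pow_succ 2 r, mul_two]
  exact hasRationalRank_hankel (fun l => dctCos (2 ^ (r + 2)) (5 ^ l) 1) ha hb s s'

theorem HasRationalRank.dctCos_two_mul {N t t' : ℕ}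
    (even : HasRationalRank (of fun x y => dctCos N (k x / 2) (j y)) t)
    (odd : HasRationalRank (of fun x y => dctCos (2 * N) (2 * (k x / 2) + 1) (j y)) t') :
    HasRationalRank (of fun x y => dctCos (2 * N) (k x) (j y)) (t + t') := by
  convert even.ite_rows (fun x => Even (k x)) odd using 1
  ext x y
  rcases Int.even_or_odd (k x) with hx | hx
  · have := dctCos_mul_mul_left (N := N) (k x / 2) (j y) two_ne_zero
    simp [hx, ← this, Int.two_mul_ediv_two_of_even hx]
  · simp [Int.not_even_iff_odd.2 hx, Int.two_mul_ediv_two_add_one_of_odd hx]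

/-- The bound for the rational rank of the matrix with entries `cos (π (2 k + 1) j / 2 ^ (r + 1))`,
a DCT-III of length `2 ^ r`, that repeated splitting by the parity of `j` gives. -/
def dct3Rank : ℕ → ℕ
  | 0 => 0
  | r + 1 => dct3Rank r + (2 ^ (r + 1) - 1)

theorem hasRationalRank_dctCos_odd (hk : ∀ x, Odd (k x)) (r : ℕ) :
    HasRationalRank (of fun x y => dctCos (2 ^ (r + 1)) (k x) (j y)) (dct3Rank r) := by
  induction r generalizing j with
  | zero => exact .of_forall_ratCast fun x y => exists_dctCos_two_eq_ratCast _ _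
  | succ r ih =>
    have even := (ih fun y => j y / 2).transpose
    have odd := (hasRationalRank_dctCos_odd_odd k (fun y => 2 * (j y / 2) + 1) hk
      (fun y => odd_two_mul_add_one _) r).transpose
    simp only [transpose, of_apply, dctCos_comm (k _)] at even odd ⊢
    rw [pow_succ'] at odd
    simpa only [transpose, of_apply, ← pow_succ', dctCos_comm (j _), dct3Rank] using
      (HasRationalRank.dctCos_two_mul j k even odd).transpose

/-- The bound for the rational rank of the matrix with entries `cos (π k j / 2 ^ m)`, and hence for
the cost of a scaled DCT-II of length `2 ^ m`, that repeated splitting by the parity of `k`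
gives. -/
def scaledDCT2Rank : ℕ → ℕ
  | 0 => 0
  | m + 1 => scaledDCT2Rank m + dct3Rank m

theorem hasRationalRank_dctCos (m : ℕ) :
    HasRationalRank (of fun x y => dctCos (2 ^ m) (k x) (j y)) (scaledDCT2Rank m) := by
  induction m generalizing k with
  | zero =>
    refine .of_forall_ratCast fun x y => ?_
    rw [of_apply, pow_zero, ← dctCos_mul_mul_left (k x) (j y) two_ne_zero]
    exact exists_dctCos_two_eq_ratCast _ _
  | succ m ih =>
    have odd := hasRationalRank_dctCos_odd (fun x => 2 * (k x / 2) + 1) j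
      (fun x => odd_two_mul_add_one _) m
    rw [pow_succ'] at odd ⊢
    exact (ih fun x => k x / 2).dctCos_two_mul k j odd

end DctCosRank

theorem dct3Rank_eq (r : ℕ) : (dct3Rank r : ℝ) = 2 * 2 ^ r - 2 - r := by
  induction r with
  | zero => norm_num [dct3Rank]
  | succ r ih =>
    rw [dct3Rank, Nat.cast_add, ih, Nat.cast_sub Nat.one_le_two_pow]
    push_cast
    ring

theorem scaledDCT2Rank_eq (m : ℕ) :
    (scaledDCT2Rank m : ℝ) = 2 * 2 ^ m - (m * (m + 3) + 4) / 2 := by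
  induction m with
  | zero => norm_num [scaledDCT2Rank]
  | succ m ih =>
    rw [scaledDCT2Rank, Nat.cast_add, ih, dct3Rank_eq]
    push_cast
    ring

/-- The coefficient of `cos (2 j φ)` in the expansion of `cos ((2 n + 1) φ) / cos φ`, given by the
recursion that `cos ((2 n + 3) φ) + cos ((2 n + 1) φ) = 2 cos φ cos (2 (n + 1) φ)` yields. -/
def cosQuotCoeff : ℕ → ℕ → ℚ
  | 0, j => if j = 0 then 1 else 0
  | n + 1, j => (if j = n + 1 then 2 else 0) - cosQuotCoeff n j

theorem cos_two_mul_add_one_mul (φ : ℝ) {n N : ℕ} (hn : n < N) : Real.cos ((2 * n + 1) * φ) =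
    Real.cos φ * ∑ j ∈ Finset.range N, Real.cos (2 * j * φ) * cosQuotCoeff n j := by
  induction n with
  | zero => simp [cosQuotCoeff, apply_ite, hn]
  | succ n ih =>
    have sum_to_product : Real.cos ((2 * (n + 1 : ℕ) + 1) * φ) + Real.cos ((2 * n + 1) * φ) =
        Real.cos φ * (Real.cos (2 * (n + 1 : ℕ) * φ) * 2) := by
      rw [Real.cos_add_cos]
      push_cast
      ring_nf
    rw [eq_sub_of_add_eq sum_to_product, ih (by lia), ← mul_sub]
    simp [cosQuotCoeff, apply_ite, mul_sub, hn]

theorem dct2_eq_diagonal_mul (N : ℕ) :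
    dct2 N = diagonal (fun k : Fin N => dctCos (2 * N) k 1) *
      ((of fun k j : Fin N => dctCos N k j) *
        (of fun j n : Fin N => cosQuotCoeff n j).map ((↑) : ℚ → ℝ)) := by
  ext k n
  have hN : N ≠ 0 := (Fin.pos n).ne'
  have even_entry (j : ℕ) : dctCos N k j = Real.cos (2 * j * (k * (Real.pi / (2 * N)))) := by
    rw [dctCos]
    congr 1
    push_cast
    field_simp
  have odd_entry (l : ℤ) : dctCos (2 * N) k l = Real.cos (l * (k * (Real.pi / (2 * N)))) := by
    rw [dctCos]
    congr 1
    push_cast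
    ring
  rw [dct2_apply, diagonal_mul, mul_apply, odd_entry, odd_entry]
  simp only [of_apply, map_apply, even_entry]
  rw [Fin.sum_univ_eq_sum_range
    fun j => Real.cos (2 * j * (k * (Real.pi / (2 * N)))) * cosQuotCoeff n j]
  simpa using cos_two_mul_add_one_mul (k * (Real.pi / (2 * N))) n.2

theorem isScaledDCT2_of_eq_diagonal_mul {N : ℕ} {S : Matrix (Fin N) (Fin N) ℝ} {d : Fin N → ℝ}
    (h : dct2 N = diagonal d * S) : IsScaledDCT2 S :=
  ⟨1, d, by simpa using h⟩

theorem exists_isScaledDCT2_two_pow (m : ℕ) : ∃ S : Matrix (Fin (2 ^ m)) (Fin (2 ^ m)) ℝ,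
    IsScaledDCT2 S ∧ ComputesWith S (scaledDCT2Rank m) := by
  have rank := (hasRationalRank_dctCos (fun k : Fin (2 ^ m) => (k : ℤ))
    (fun j : Fin (2 ^ m) => (j : ℤ)) m).mul_ratCast (of fun j n : Fin (2 ^ m) => cosQuotCoeff n j)
  obtain ⟨D, hD, computes⟩ := rank.exists_computesWith
  refine ⟨_, isScaledDCT2_of_eq_diagonal_mul
    (d := fun k : Fin (2 ^ m) => D⁻¹ * dctCos (2 * 2 ^ m) k 1) ?_, computes⟩
  ext k n
  rw [dct2_eq_diagonal_mul, diagonal_mul, diagonal_mul, Matrix.smul_apply, smul_eq_mul]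
  field_simp

/-! ### The prime factor algorithm -/

/-- Congruence up to sign, the relation between sample positions that the prime factor index map
is made of. -/
def ModEqUpToSign (n x y : ℤ) : Prop :=
  x ≡ y [ZMOD n] ∨ x ≡ -y [ZMOD n]

namespace ModEqUpToSign

variable {n x y z : ℤ}

theorem symm (h : ModEqUpToSign n x y) : ModEqUpToSign n y x :=
  h.imp Int.ModEq.symm fun h => by simpa using h.symm.neg

theorem trans (hxy : ModEqUpToSign n x y) (hyz : ModEqUpToSign n y z) : ModEqUpToSign n x z := by
  rcases hxy with hxy | hxy <;> rcases hyz with hyz | hyz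
  · exact .inl (hxy.trans hyz)
  · exact .inr (hxy.trans hyz)
  · exact .inr (hxy.trans hyz.neg)
  · exact .inl (by simpa using hxy.trans hyz.neg)

theorem mul_of_isCoprime {p q : ℤ} (hpq : IsCoprime p q) (hy : Odd y)
    (hp : ModEqUpToSign (4 * p) x y) (hq : ModEqUpToSign (4 * q) x y) :
    ModEqUpToSign (4 * (p * q)) x y := by
  have combine {z : ℤ} (h : x ≡ z [ZMOD 4 * p]) (h' : x ≡ z [ZMOD 4 * q]) :
      x ≡ z [ZMOD 4 * (p * q)] := by
    obtain ⟨w, hw⟩ := (dvd_mul_right 4 p).trans h.dvd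
    rw [Int.modEq_iff_dvd, hw, mul_dvd_mul_iff_left four_ne_zero] at h h' ⊢
    exact hpq.mul_dvd h h'
  have signs_agree (h : x ≡ y [ZMOD 4]) (h' : x ≡ -y [ZMOD 4]) : False := by
    obtain ⟨w, rfl⟩ := hy
    simp only [Int.ModEq] at h h'
    lia
  rcases hp with hp | hp <;> rcases hq with hq | hq
  · exact .inl (combine hp hq)
  · exact (signs_agree hp.of_mul_right hq.of_mul_right).elim
  · exact (signs_agree hq.of_mul_right hp.of_mul_right).elim
  · exact .inr (combine hp hq)

theorem eq_of_lt {N a b : ℕ} (h : ModEqUpToSign (4 * N) (2 * a + 1) (2 * b + 1)) (ha : a < N)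
    (hb : b < N) : a = b := by
  rcases h with h | h
  · have := Int.eq_zero_of_abs_lt_dvd h.dvd (by rw [abs_lt]; constructor <;> lia)
    lia
  · have := Int.eq_zero_of_abs_lt_dvd h.dvd (by rw [abs_lt]; constructor <;> lia)
    lia

end ModEqUpToSign

theorem exists_fin_modEqUpToSign {p : ℕ} (hp : 0 < p) (n : ℕ) :
    ∃ a : Fin p, ModEqUpToSign (4 * p) (2 * n + 1) (2 * (a : ℕ) + 1) := by
  have division : (2 * p * (n / (2 * p) : ℕ) + (n % (2 * p) : ℕ) : ℤ) = n :=
    mod_cast Nat.div_add_mod n (2 * p)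
  have remainder_lt := Nat.mod_lt n (show 0 < 2 * p by lia)
  by_cases h : n % (2 * p) < p
  · refine ⟨⟨_, h⟩, .inl (Int.modEq_iff_dvd.2 ⟨-(n / (2 * p) : ℕ), ?_⟩)⟩
    linear_combination 2 * division
  · refine ⟨⟨2 * p - 1 - n % (2 * p), by lia⟩,
      .inr (Int.modEq_iff_dvd.2 ⟨-(n / (2 * p) : ℕ) - 1, ?_⟩)⟩
    have cast_sub : ((2 * p - 1 - n % (2 * p) : ℕ) : ℤ) = 2 * p - 1 - (n % (2 * p) : ℕ) := by lia
    rw [Fin.val_mk, cast_sub]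
    linear_combination 2 * division

theorem exists_isPrimeFactorMap {p q : ℕ} (hp : 0 < p) (hq : 0 < q) (hpq : p.Coprime q) :
    ∃ e : Fin (q * p) ≃ Fin p × Fin q, IsPrimeFactorMap e := by
  choose a ha using fun n : Fin (q * p) => exists_fin_modEqUpToSign hp n
  choose b hb using fun n : Fin (q * p) => exists_fin_modEqUpToSign hq n
  have injective : Function.Injective fun n => (a n, b n) := by
    intro n n' h
    obtain ⟨hab, hbb⟩ := Prod.mk.inj h
    have congr_p := (ha n).trans (hab ▸ (ha n').symm)
    have congr_q := (hb n).trans (hbb ▸ (hb n').symm)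
    have congr_qp := congr_q.mul_of_isCoprime (Nat.isCoprime_iff_coprime.2 hpq.symm)
      (odd_two_mul_add_one _) congr_p
    exact Fin.ext (ModEqUpToSign.eq_of_lt (mod_cast congr_qp) n.2 n'.2)
  have bijective := (Fintype.bijective_iff_injective_and_card _).2
    ⟨injective, by simp [mul_comm]⟩
  exact ⟨.ofBijective _ bijective, fun n => ⟨ha n, hb n⟩⟩

theorem dctCos_eq_of_modEqUpToSign {N : ℕ} (hN : N ≠ 0) (u : ℤ) {x y : ℤ}
    (h : ModEqUpToSign (2 * N) x y) : dctCos N u x = dctCos N u y := by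
  rw [dctCos_comm u x, dctCos_comm u y]
  wlog congr : x ≡ y [ZMOD 2 * N] generalizing y with of_congr
  · rw [← dctCos_neg_left y]
    exact of_congr (.inl (h.resolve_left congr)) (h.resolve_left congr)
  obtain ⟨t, rfl⟩ := Int.modEq_iff_add_fac.1 congr
  rw [show x + 2 * N * t = x + N * (2 * t) by ring, dctCos_add_mul_left _ _ hN, mul_assoc,
    (even_two_mul _).neg_one_zpow, one_mul]

theorem IsPrimeFactorMap.dct2_kronecker_apply {p q : ℕ} {e : Fin (q * p) ≃ Fin p × Fin q}
    (he : IsPrimeFactorMap e) (i : Fin p × Fin q) (n : Fin (q * p)) :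
    (dct2 p ⊗ₖ dct2 q) i (e n) =
      dctCos (2 * p) i.1 (2 * n + 1) * dctCos (2 * q) i.2 (2 * n + 1) := by
  have congr_p : ModEqUpToSign (2 * (2 * p : ℕ)) (2 * n + 1) (2 * (e n).1 + 1) := by
    rw [show (2 * (2 * p : ℕ) : ℤ) = 4 * p by push_cast; ring]
    exact (he n).1
  have congr_q : ModEqUpToSign (2 * (2 * q : ℕ)) (2 * n + 1) (2 * (e n).2 + 1) := by
    rw [show (2 * (2 * q : ℕ) : ℤ) = 4 * q by push_cast; ring]
    exact (he n).2
  have hp : 2 * p ≠ 0 := by have := i.1.pos; lia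
  have hq : 2 * q ≠ 0 := by have := i.2.pos; lia
  rw [kroneckerMap_apply, dct2_apply, dct2_apply, dctCos_eq_of_modEqUpToSign hp _ congr_p,
    dctCos_eq_of_modEqUpToSign hq _ congr_q]

theorem dctCos_two_mul_self {N : ℕ} (hN : N ≠ 0) {x : ℤ} (hx : Odd x) :
    dctCos (2 * N) N x = 0 := by
  obtain ⟨w, rfl⟩ := hx
  rw [dctCos, Real.cos_eq_zero_iff]
  refine ⟨w, ?_⟩
  push_cast
  field_simp

theorem dctCos_self_sub {N : ℕ} (hN : N ≠ 0) (u : ℤ) {x : ℤ} (hx : Odd x) :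
    dctCos N (N - u) x = -dctCos N u x := by
  have h := dctCos_add_mul_left (-u) x hN 1
  rwa [mul_one, one_mul, hx.neg_one_zpow, dctCos_neg_left, neg_one_mul, neg_add_eq_sub] at h

theorem dctCos_mul_add_mul {p q : ℕ} (hp : p ≠ 0) (hq : q ≠ 0) (u v : ℤ) {x : ℤ} (hx : Odd x) :
    dctCos (2 * (q * p)) (u * q + v * p) x = dctCos (2 * p) u x * dctCos (2 * q) v x -
      dctCos (2 * p) (p - u) x * dctCos (2 * q) (q - v) x := by
  set α : ℝ := u * x * (Real.pi / (2 * p : ℕ)) with hα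
  set β : ℝ := v * x * (Real.pi / (2 * q : ℕ)) with hβ
  set θ : ℝ := x * (Real.pi / 2) with hθ
  have cos_θ : Real.cos θ = 0 := by
    simpa [dctCos, hθ] using dctCos_two_mul_self one_ne_zero hx
  have sin_θ : Real.sin θ * Real.sin θ = 1 := by
    nlinarith [Real.sin_sq_add_cos_sq θ]
  have angle : dctCos (2 * (q * p)) (u * q + v * p) x = Real.cos (α + β) := by
    rw [dctCos, hα, hβ]
    congr 1
    push_cast
    field_simp
  have angle_p : dctCos (2 * p) (p - u) x = Real.cos (θ - α) := by
    rw [dctCos, hθ, hα]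
    congr 1
    push_cast
    field_simp
  have angle_q : dctCos (2 * q) (q - v) x = Real.cos (θ - β) := by
    rw [dctCos, hθ, hβ]
    congr 1
    push_cast
    field_simp
  rw [angle, angle_p, angle_q, Real.cos_add, Real.cos_sub, Real.cos_sub, cos_θ]
  change _ = Real.cos α * Real.cos β - _
  linear_combination Real.sin α * Real.sin β * sin_θ

theorem exists_eq_mul_add_mul {p q K : ℕ} (hpq : p.Coprime q) (hK : K < q * p) :
    ∃ u v : ℤ, 0 ≤ u ∧ u < p ∧ |v| < q ∧ (K : ℤ) = u * q + v * p := by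
  obtain ⟨a, b, hab⟩ := Nat.isCoprime_iff_coprime.2 hpq
  have hp : (0 : ℤ) < p := mod_cast Nat.pos_of_mul_pos_left (pos_of_gt hK)
  have hq : (0 : ℤ) < q := mod_cast Nat.pos_of_mul_pos_right (pos_of_gt hK)
  have hK' : (K : ℤ) < q * p := mod_cast hK
  obtain ⟨u, v, hu, hup, huv⟩ : ∃ u v : ℤ, 0 ≤ u ∧ u < p ∧ (K : ℤ) = u * q + v * p := by
    refine ⟨K * b % p, K * a + K * b / p * q, Int.emod_nonneg _ hp.ne', Int.emod_lt_of_pos _ hp, ?_⟩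
    linear_combination (-(K : ℤ)) * hab - q * Int.emod_add_mul_ediv (K * b) p
  have uq_nonneg : 0 ≤ u * q := mul_nonneg hu hq.le
  have uq_lt : u * q < p * q := mul_lt_mul_of_pos_right hup hq
  refine ⟨u, v, hu, hup, abs_lt.2 ⟨?_, ?_⟩, huv⟩
  · exact lt_of_mul_lt_mul_right (a := (p : ℤ)) (by linarith [hK']) hp.le
  · exact lt_of_mul_lt_mul_right (a := (p : ℤ)) (by linarith [hK']) hp.le

theorem exists_dctCos_eq_mul_add_mul {p q K : ℕ} (hpq : p.Coprime q) (hK : K < q * p) :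
    ∃ u < p, ∃ v < q, ∃ ε : ℤ, ε * ε = 1 ∧ ∀ x, Odd x →
      dctCos (2 * (q * p)) K x = dctCos (2 * p) u x * dctCos (2 * q) v x +
        ε * (dctCos (2 * p) (p - u : ℤ) x * dctCos (2 * q) (q - v : ℤ) x) := by
  obtain ⟨u, v, hu, hup, hvq, hKuv⟩ := exists_eq_mul_add_mul hpq hK
  have hp : p ≠ 0 := by lia
  have hq : q ≠ 0 := by rintro rfl; simp at hK
  lift u to ℕ using hu
  obtain ⟨w, rfl | rfl⟩ := v.eq_nat_or_neg
  · refine ⟨u, mod_cast hup, w, by simpa using hvq, -1, by norm_num, fun x hx => ?_⟩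
    rw [hKuv, dctCos_mul_add_mul hp hq _ _ hx]
    push_cast
    ring
  · refine ⟨u, mod_cast hup, w, by simpa using hvq, 1, by norm_num, fun x hx => ?_⟩
    have reflect : dctCos (2 * q) (q - -w : ℤ) x = -dctCos (2 * q) (q - w : ℤ) x := by
      rw [← dctCos_self_sub (by lia) _ hx]
      congr 1
      push_cast
      ring
    rw [hKuv, dctCos_mul_add_mul hp hq _ _ hx, reflect, dctCos_neg_left]
    push_cast
    ring

/-- The last stage of the prime factor algorithm consists of one butterfly, a sum and a difference
of two products of one frequency each, for every `r` in `Fin (p - 1) × Fin (q / 2)`. This is the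
pair of frequencies `(r.1 + 1, r.2 + 1)` of its first product. -/
def butterflyLow {p q : ℕ} (r : Fin (p - 1) × Fin (q / 2)) : Fin p × Fin q :=
  (⟨r.1 + 1, by lia⟩, ⟨r.2 + 1, by lia⟩)

/-- The pair of frequencies of the second product of a butterfly, complementary to
`butterflyLow`. -/
def butterflyHigh {p q : ℕ} (r : Fin (p - 1) × Fin (q / 2)) : Fin p × Fin q :=
  (⟨p - (r.1 + 1), by lia⟩, ⟨q - (r.2 + 1), by lia⟩)

theorem exists_butterfly {p q u v : ℕ} (hu : u ≠ 0) (hup : u < p) (hv : v ≠ 0) (hvq : v < q) :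
    ∃ r : Fin (p - 1) × Fin (q / 2),
      (butterflyLow r = (⟨u, hup⟩, ⟨v, hvq⟩) ∧
        butterflyHigh r = (⟨p - u, by lia⟩, ⟨q - v, by lia⟩)) ∨
      (butterflyLow r = (⟨p - u, by lia⟩, ⟨q - v, by lia⟩) ∧
        butterflyHigh r = (⟨u, hup⟩, ⟨v, hvq⟩)) := by
  simp only [butterflyLow, butterflyHigh, Prod.mk.injEq, Fin.mk.injEq]
  by_cases hv_half : v ≤ q / 2
  · exact ⟨(⟨u - 1, by lia⟩, ⟨v - 1, by lia⟩), .inl (by simp only; lia)⟩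
  · exact ⟨(⟨p - u - 1, by lia⟩, ⟨q - v - 1, by lia⟩), .inr (by simp only; lia)⟩

theorem IsPrimeFactorMap.dct2_eq_butterfly {p q : ℕ} {e : Fin (q * p) ≃ Fin p × Fin q}
    (he : IsPrimeFactorMap e) (hpq : p.Coprime q) (K : Fin (q * p)) :
    (∃ i, ∀ n, dct2 (q * p) K n = (dct2 p ⊗ₖ dct2 q) i (e n)) ∨
      ∃ r, ∃ δ ε : ℤ, ∀ n, dct2 (q * p) K n =
        δ * ((dct2 p ⊗ₖ dct2 q) (butterflyLow r) (e n) +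
          ε * (dct2 p ⊗ₖ dct2 q) (butterflyHigh r) (e n)) := by
  obtain ⟨u, hup, v, hvq, ε, hε, hK⟩ := exists_dctCos_eq_mul_add_mul hpq K.2
  have row (n : Fin (q * p)) := hK (2 * n + 1) (odd_two_mul_add_one _)
  simp only [he.dct2_kronecker_apply, dct2_apply]
  by_cases hu : u = 0
  · refine .inl ⟨(⟨u, hup⟩, ⟨v, hvq⟩), fun n => ?_⟩
    rw [row, show (p - u : ℤ) = p by lia, dctCos_two_mul_self (by lia) (odd_two_mul_add_one _),
      zero_mul, mul_zero, add_zero]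
  by_cases hv : v = 0
  · refine .inl ⟨(⟨u, hup⟩, ⟨v, hvq⟩), fun n => ?_⟩
    rw [row, show (q - v : ℤ) = q by lia, dctCos_two_mul_self (N := q) (by lia)
      (odd_two_mul_add_one _), mul_zero, mul_zero, add_zero]
  right
  obtain ⟨r, ⟨low, high⟩ | ⟨low, high⟩⟩ := exists_butterfly hu hup hv hvq
  · refine ⟨r, 1, ε, fun n => ?_⟩
    rw [row, low, high, Nat.cast_sub hup.le, Nat.cast_sub hvq.le, Int.cast_one, one_mul]
  · refine ⟨r, ε, ε, fun n => ?_⟩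
    have hε' : (ε * ε : ℝ) = 1 := mod_cast hε
    rw [row, low, high, mul_add, ← mul_assoc (ε : ℝ) ε, hε', one_mul, add_comm,
      Nat.cast_sub hup.le, Nat.cast_sub hvq.le]

theorem dctCos_two_mul_one_pos {N k : ℕ} (hk : k < N) : 0 < dctCos (2 * N) k 1 := by
  have hN : (0 : ℝ) < N := mod_cast pos_of_gt hk
  have angle : ((k : ℤ) : ℝ) * (1 : ℤ) * (Real.pi / (2 * N : ℕ)) = k / N * (Real.pi / 2) := by
    push_cast
    field_simp
  have ratio_lt : (k / N : ℝ) < 1 := (div_lt_one hN).2 (mod_cast hk)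
  rw [dctCos, angle]
  refine Real.cos_pos_of_mem_Ioo ⟨?_, ?_⟩
  · linarith [Real.pi_pos, show 0 ≤ (k / N : ℝ) * (Real.pi / 2) by positivity]
  · exact mul_lt_of_lt_one_left (by positivity) ratio_lt

theorem IsScaledDCT2.exists_row {N : ℕ} {S : Matrix (Fin N) (Fin N) ℝ} (h : IsScaledDCT2 S) :
    ∃ (f : Fin N → Fin N) (c : Fin N → ℝ), (∀ k, c k ≠ 0) ∧
      ∀ k n, dct2 N k n = c k * S (f k) n := by
  obtain ⟨σ, d, h⟩ := h
  have row (k n) : dct2 N k n = d (σ k) * S (σ k) n := by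
    rw [h, Matrix.mul_assoc, PEquiv.toMatrix_toPEquiv_mul, submatrix_apply, diagonal_mul, id]
  refine ⟨σ, d ∘ σ, fun k hk => (dctCos_two_mul_one_pos k.2).ne' ?_, row⟩
  simpa [dct2_apply, show d (σ k) = 0 from hk] using row k ⟨0, k.pos⟩

theorem exists_eq_diagonal_mul_of_butterfly {ι κ μ ρ : Type} [Fintype ι]
    [Fintype κ] [DecidableEq κ] [Fintype ρ] [Nonempty ι] {low high : ρ → ι}
    {φ : ι → ι} {c : ι → ℝ} {Z T : Matrix ι μ ℝ} {X : Matrix κ μ ℝ} (hc : ∀ i, c i ≠ 0)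
    (hZ : ∀ i y, Z i y = c i * T (φ i) y)
    (hX : ∀ k, (∃ i, ∀ y, X k y = Z i y) ∨
      ∃ r, ∃ δ ε : ℤ, ∀ y, X k y = δ * (Z (low r) y + ε * Z (high r) y)) :
    ∃ (M : Matrix κ ι ℝ) (d : κ → ℝ),
      ComputesWith M (Fintype.card ρ) ∧ X = diagonal d * (M * T) := by
  classical
  have row (k : κ) : ∃ (i : ι) (d : ℝ) (C : ρ → ℤ), ∀ y, X k y = d * (T i y +
      ∑ r, C r * (c (high r) / c (low r) * T (φ (high r)) y)) := by
    obtain ⟨i, hi⟩ | ⟨r, δ, ε, hr⟩ := hX k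
    · exact ⟨φ i, c i, 0, fun y => by simp [hi, hZ]⟩
    · refine ⟨φ (low r), δ * c (low r), Pi.single r ε, fun y => ?_⟩
      rw [Finset.sum_eq_single r (fun r' _ hr' => by simp [Pi.single_eq_of_ne hr']) (by simp),
        Pi.single_eq_same, hr, hZ, hZ]
      have := hc (low r)
      field_simp
  choose i d C h using row
  refine ⟨_, d, computesWith_add_mul_diagonal_mul ((1 : Matrix ι ι ℤ).submatrix i id) (of C)
    (fun r => c (high r) / c (low r)) ((1 : Matrix ι ι ℤ).submatrix (φ ∘ high) id), ?_⟩
  have select {α : Type} (f : α → ι) :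
      ((1 : Matrix ι ι ℤ).submatrix f id).map ((↑) : ℤ → ℝ) * T = T.submatrix f id := by
    rw [← submatrix_map, Matrix.map_one _ Int.cast_zero Int.cast_one]
    exact one_submatrix_mul f (Equiv.refl ι) T
  ext k y
  rw [diagonal_mul, h, Matrix.add_mul, Matrix.mul_assoc, Matrix.mul_assoc, select, select,
    Matrix.add_apply, Matrix.mul_apply]
  simp only [submatrix_apply, map_apply, of_apply, diagonal_mul, id, Function.comp_apply]

/-- The number of multiplications of the prime factor algorithm for the length `q * p`: those of `p`
transforms of length `q` with `s` multiplications each, those of `q` transforms of length `p` with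
`a` multiplications each, and one for every butterfly of the last stage. -/
def pfaMulCount (q p s a : ℕ) : ℕ :=
  p * s + q * a + (p - 1) * (q / 2)

theorem exists_scaledPFA_of_coprime {p q s a : ℕ} (hp : 0 < p) (hq : 0 < q) (hpq : p.Coprime q)
    {Sq : Matrix (Fin q) (Fin q) ℝ} (hSq : IsScaledDCT2 Sq) (hs : ComputesWith Sq s)
    {Sp : Matrix (Fin p) (Fin p) ℝ} (hSp : IsScaledDCT2 Sp) (ha : ComputesWith Sp a) :
    ∃ A : ScaledPFA q p, A.Sq = Sq ∧ A.UsesMul s (pfaMulCount q p s a) := by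
  have : Nonempty (Fin p × Fin q) := ⟨⟨0, hp⟩, ⟨0, hq⟩⟩
  obtain ⟨e, he⟩ := exists_isPrimeFactorMap hp hq hpq
  obtain ⟨f, c, hc, hdct_p⟩ := hSp.exists_row
  obtain ⟨g, d, hd, hdct_q⟩ := hSq.exists_row
  obtain ⟨merge, D, hmerge, hresult⟩ := exists_eq_diagonal_mul_of_butterfly
    (c := fun i : Fin p × Fin q => c i.1 * d i.2) (φ := Prod.map f g)
    (Z := (dct2 p ⊗ₖ dct2 q).submatrix id e) (T := (Sp ⊗ₖ Sq).submatrix id e)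
    (fun i => mul_ne_zero (hc i.1) (hd i.2))
    (fun i n => by
      simp only [submatrix_apply, kroneckerMap_apply, hdct_p, hdct_q, id, Prod.map]
      ring)
    (he.dct2_eq_butterfly hpq)
  refine ⟨⟨e, he, Sq, hSq, Sp, hSp, merge, ?_⟩, rfl, a, _, hs, ha, by simpa using hmerge, rfl⟩
  rw [← mul_kronecker_mul, Matrix.mul_one, Matrix.one_mul]
  exact isScaledDCT2_of_eq_diagonal_mul hresult

theorem pfaMulCount_two_pow {q : ℕ} (hq : Odd q) (m s : ℕ) :
    (pfaMulCount q (2 ^ m) s (scaledDCT2Rank m) : ℝ) =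
      2 ^ m * (s : ℝ) + 5 / 2 * ((q * 2 ^ m : ℕ) : ℝ)
        - (q : ℝ) * (((m : ℝ) * ((m : ℝ) + 3) + 5) / 2)
        - (2 : ℝ) ^ ((m : ℤ) - 1) + 1 / 2 := by
  obtain ⟨h, rfl⟩ := hq
  rw [pfaMulCount, zpow_sub_one₀ two_ne_zero, zpow_natCast, show (2 * h + 1) / 2 = h by lia]
  push_cast [Nat.cast_sub Nat.one_le_two_pow, scaledDCT2Rank_eq]
  ring

theorem scaledMulComplexity_le {N t : ℕ} {S : Matrix (Fin N) (Fin N) ℝ} (hS : IsScaledDCT2 S)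
    (ht : ComputesWith S t) : scaledMulComplexity N ≤ t :=
  Nat.sInf_le ⟨S, hS, ht⟩

theorem proposition3 (q m : ℕ) (hq : Odd q) :
    (∀ (Sq : Matrix (Fin q) (Fin q) ℝ) (s : ℕ), IsScaledDCT2 Sq → ComputesWith Sq s →
      ∃ (A : ScaledPFA q (2 ^ m)) (t : ℕ),
        A.Sq = Sq ∧ A.UsesMul s t ∧ ComputesWith A.matrix t ∧
        (t : ℝ) ≤ 2 ^ m * (s : ℝ) + 5 / 2 * ((q * 2 ^ m : ℕ) : ℝ)
          - (q : ℝ) * (((m : ℝ) * ((m : ℝ) + 3) + 5) / 2)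
          - (2 : ℝ) ^ ((m : ℤ) - 1) + 1 / 2) ∧
    (scaledMulComplexity (q * 2 ^ m) : ℝ) ≤
      2 ^ m * (scaledMulComplexity q : ℝ) + 5 / 2 * ((q * 2 ^ m : ℕ) : ℝ)
        - (q : ℝ) * (((m : ℝ) * ((m : ℝ) + 3) + 5) / 2)
        - (2 : ℝ) ^ ((m : ℤ) - 1) + 1 / 2 := by
  have exists_scaledPFA {Sq : Matrix (Fin q) (Fin q) ℝ} {s : ℕ} (hSq : IsScaledDCT2 Sq)
      (hs : ComputesWith Sq s) : ∃ A : ScaledPFA q (2 ^ m), A.Sq = Sq ∧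
        A.UsesMul s (pfaMulCount q (2 ^ m) s (scaledDCT2Rank m)) := by
    obtain ⟨Sp, hSp, ha⟩ := exists_isScaledDCT2_two_pow m
    exact exists_scaledPFA_of_coprime (by positivity) hq.pos (hq.coprime_two_left.pow_left m)
      hSq hs hSp ha
  refine ⟨fun Sq s hSq hs => ?_, ?_⟩
  · obtain ⟨A, hA, hmul⟩ := exists_scaledPFA hSq hs
    exact ⟨A, _, hA, hmul, hmul.computesWith, (pfaMulCount_two_pow hq m s).le⟩
  · obtain ⟨S, hS, hs⟩ := scaledMulComplexity_spec q hq.pos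
    obtain ⟨A, -, hmul⟩ := exists_scaledPFA hS hs
    rw [← pfaMulCount_two_pow hq]
    exact_mod_cast scaledMulComplexity_le A.result_scaled hmul.computesWith
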